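/- Let $G$ be a finite simple graph with $n$ vertices, adjacency matrix $A$ and diagonal degree matrix $D$, let $\delta$ be its minimum degree and $g$ its girth (the length of a shortest cycle), and let $\tau(G)$ be the maximum number of pairwise edge-disjoint spanning trees of $G$. Let $k\ge 1$ be an integer with $\delta \ge 2k$ (so that $G$ has a cycle, $3\le g<\infty$ and $n\ge 3$). Put $t=\lfloor (g-1)/2\rfloor$ and $$n_1^*=\begin{cases}1+\delta+\sum_{i=2}^{t}(\delta-1)^i & \text{if } g=2t+1,\\[2pt] 2+2(\delta-1)^t+\sum_{i=1}^{t-1}(\delta-1)^i & \text{if } g=2t+2,\end{cases}$$ where empty sums are $0$. Let $a,b$ be real numbers with $b\ne 0$ and $a/b\ge -1$, and let $\lambda_1\ge\lambda_2\ge\dots\ge\lambda_n$ be the eigenvalues of $aD+bA$, counted with multiplicity. (i) If $b>0$ and $\lambda_2<(a+b)\delta-\dfrac{b(2k-1)}{n_1^*}$, then $\tau(G)\ge k$. (ii) If $b<0$ and $\lambda_{n-1}>(a+b)\delta-\dfrac{b(2k-1)}{n_1^*}$, then $\tau(G)\ge k$. -/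

import Mathlib

/-- `mooreTypeBound δ g` is the number `n₁*(δ, g)`, for `δ > 0` and `g ≥ 3`, with `t = ⌊(g - 1) / 2⌋`:
`1 + δ + ∑_{i=2}^{t} (δ - 1)^i` if `g = 2t + 1`, and
`2 + 2 (δ - 1)^t + ∑_{i=1}^{t-1} (δ - 1)^i` if `g = 2t + 2`. -/
def mooreTypeBound (δ g : ℕ) : ℕ :=
  let t := (g - 1) / 2
  if g = 2 * t + 1 then
    1 + δ + ∑ i ∈ Finset.Icc 2 t, (δ - 1) ^ i
  else
    2 + 2 * (δ - 1) ^ t + ∑ i ∈ Finset.Icc 1 (t - 1), (δ - 1) ^ i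

namespace SimpleGraph

/-- A family of pairwise edge-disjoint spanning trees of `G` (a spanning tree is a tree on the whole
vertex set all of whose edges are edges of `G`). -/
def IsSpanningTreePacking {V : Type*} (G : SimpleGraph V) {m : ℕ} (T : Fin m → SimpleGraph V) :
    Prop :=
  (∀ i, T i ≤ G ∧ (T i).IsTree) ∧ ∀ i j, i ≠ j → Disjoint (T i).edgeSet (T j).edgeSet

/-- The spanning tree packing number `τ(G)`: the largest `m` such that `G` contains `m` pairwise
edge-disjoint spanning trees. The value is `⊤` only if there are arbitrarily many of them, which
for a finite graph happens only for the graph with one vertex. -/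
noncomputable def spanningTreePackingNumber {V : Type*} (G : SimpleGraph V) : ℕ∞ :=
  sSup {x : ℕ∞ | ∃ (m : ℕ) (T : Fin m → SimpleGraph V), G.IsSpanningTreePacking T ∧ x = m}

section Spectrum

variable {V : Type*} [Fintype V] [DecidableEq V] (G : SimpleGraph V) [DecidableRel G.Adj]

/-- The real matrix `aD + bA`, where `D` is the diagonal matrix of degrees and `A` the adjacency
matrix. -/
def degAdjMatrix (a b : ℝ) : Matrix V V ℝ :=
  a • G.degMatrix ℝ + b • G.adjMatrix ℝ

theorem degAdjMatrix_isHermitian (a b : ℝ) : (G.degAdjMatrix a b).IsHermitian := by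
  rw [Matrix.IsHermitian, Matrix.conjTranspose_eq_transpose_of_trivial]
  simp [degAdjMatrix, degMatrix]

/-- `G.degAdjEigenvalue a b i` is the `i`-th largest eigenvalue of `aD + bA`, counted with
multiplicity, for `1 ≤ i ≤ |V|` (so `i = 1` is the largest one); it is `0` for other `i`.
`Matrix.IsHermitian.eigenvalues₀` lists the eigenvalues in nonincreasing order from index `0`. -/
noncomputable def degAdjEigenvalue (a b : ℝ) (i : ℕ) : ℝ :=
  if h : 1 ≤ i ∧ i ≤ Fintype.card V then
    (G.degAdjMatrix_isHermitian a b).eigenvalues₀ ⟨i - 1, by omega⟩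
  else 0

end Spectrum

end SimpleGraph

/-! Suppose that `G` has no `k` edge-disjoint spanning trees. By Nash-Williams–Tutte some partition
of the vertices into `s` parts has at most `k(s-1) - 1` crossing edges. Write `d` for the boundary
size of a part and `e` for the number of edges between two parts, and let `X` be a part with `d(X)`
minimal. If `d(Y) + e(X,Y) ≥ 2k` held for every other part `Y`, summing would give `2k(s-1)` as a
lower bound for the sum of all `d`, which is twice the number of crossing edges: a contradiction. So
some `Y` satisfies `d(Y) + e(X,Y) ≤ 2k - 1`, and by minimality so does `X`.

Both boundaries are then smaller than `δ`, and a breadth-first count below half the girth gives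
`|X|, |Y| ≥ n₁*` (`mooreTypeBound_le_card`).

Finally `aD + bA = (a+b)D - bL` with `L` the Laplacian. On `z = α·1_X + β·1_Y` the Laplacian form is
at most `α²(d(X) + e) + β²(d(Y) + e)`, because `(α-β)² ≤ 2α² + 2β²` on the edges between `X` and
`Y`; hence it is at most `r‖z‖²` with `r = (2k-1)/n₁*`. The condition `a/b ≥ -1` gives `a + b` the
sign of `b`, so on this plane the Rayleigh quotient is at least `(a+b)δ - br` for `b > 0` and at
most that for `b < 0`. Comparing with `λ₂` or `λ_{n-1}` contradicts the hypothesis.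

Nash-Williams–Tutte is proved by edge exchanges in a packing of `k` forests with the most edges. Let
`K` consist of the edges left uncovered by some packing reachable by exchanges. Each forest,
restricted to `K`, still connects every component of `K`, so the components of `K` form the required
partition. -/

namespace SimpleGraph

/-! ### Forest packings, edge exchanges and the Nash-Williams–Tutte theorem -/

open Finset in
/-- A forest on `n` vertices with `c` connected components has `n - c` edges. -/
theorem IsAcyclic.ncard_edgeSet_add_card_connectedComponent {V : Type*} [Fintype V]
    {H : SimpleGraph V} (hH : H.IsAcyclic) :
    H.edgeSet.ncard + Nat.card H.ConnectedComponent = Fintype.card V := by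
  classical
  have hdeg : ∀ (c : H.ConnectedComponent) (v : c), c.toSimpleGraph.degree v = H.degree v := by
    intro c v
    rw [← card_neighborFinset_eq_degree, ← card_neighborFinset_eq_degree]
    refine Finset.card_bij (fun w _ => (w : V)) ?_ ?_ ?_
    · intro w hw
      have hadj : c.toSimpleGraph.Adj v w := (mem_neighborFinset ..).1 hw
      exact (mem_neighborFinset ..).2 hadj
    · intro w _ w' _ h
      exact Subtype.ext h
    · intro w hw
      have hadj : H.Adj v w := by simpa using hw
      exact ⟨⟨w, c.mem_supp_of_adj_mem_supp v.2 hadj⟩,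
        (mem_neighborFinset ..).2 hadj, rfl⟩
  have hcomp : ∀ c : H.ConnectedComponent,
      (∑ v ∈ univ.filter (fun v => H.connectedComponentMk v = c), H.degree v) + 2 =
        2 * #(univ.filter (fun v => H.connectedComponentMk v = c)) := by
    intro c
    have htree := hH.isTree_connectedComponent c
    have h1 := htree.card_edgeFinset
    have h2 := c.toSimpleGraph.sum_degrees_eq_twice_card_edges
    have h3 : ∑ v ∈ univ.filter (fun v => H.connectedComponentMk v = c), H.degree v =
        ∑ v : c, c.toSimpleGraph.degree v := by
      rw [Finset.sum_congr rfl (fun v _ => hdeg c v)]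
      exact Finset.sum_subtype _ (fun v => by simp; rfl) _
    have h4 : Fintype.card c = #(univ.filter (fun v => H.connectedComponentMk v = c)) :=
      Fintype.card_of_subtype _ (fun v => by simp; rfl)
    omega
  have hsum : ∑ v, H.degree v + 2 * Fintype.card H.ConnectedComponent = 2 * Fintype.card V := by
    rw [← Finset.sum_fiberwise univ H.connectedComponentMk (fun v => H.degree v), ← Finset.card_univ (α := V),
      Finset.card_eq_sum_card_fiberwise (f := H.connectedComponentMk) (t := univ) (by simp),
      Finset.mul_sum, ← Finset.sum_congr rfl (fun c _ => hcomp c), Finset.sum_add_distrib]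
    simp [mul_comm]
  have h5 := H.sum_degrees_eq_twice_card_edges
  rw [Set.ncard_eq_toFinset_card', Nat.card_eq_fintype_card]
  have h6 : #H.edgeSet.toFinset = #H.edgeFinset := rfl
  omega

/-- A family of pairwise edge-disjoint forests in `G`. -/
def IsForestPacking {V ι : Type*} (G : SimpleGraph V) (F : ι → SimpleGraph V) : Prop :=
  (∀ i, F i ≤ G ∧ (F i).IsAcyclic) ∧ ∀ i j, i ≠ j → Disjoint (F i) (F j)

/-- The adjacent pairs of `G` that lie in none of the graphs `F i`. -/
def IsUncovered {V ι : Type*} (G : SimpleGraph V) (F : ι → SimpleGraph V) (x y : V) : Prop :=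
  G.Adj x y ∧ ∀ i, ¬ (F i).Adj x y

/-- The family `F'` arises from `F` by exchanging one edge of some `F i` for an uncovered edge of
`G` that reconnects its endpoints. -/
def IsEdgeExchange {V ι : Type*} [DecidableEq ι] (G : SimpleGraph V)
    (F F' : ι → SimpleGraph V) : Prop :=
  ∃ (i : ι) (x y u v : V), G.IsUncovered F x y ∧ (F i).Adj u v ∧
    ¬ ((F i).deleteEdges {s(u, v)}).Reachable x y ∧
    F' = Function.update F i ((F i).deleteEdges {s(u, v)} ⊔ edge x y)

section Exchange

variable {V ι : Type*} [DecidableEq ι] {G : SimpleGraph V}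
  {F F' F₀ : ι → SimpleGraph V}

/-- The number of edges of a family of graphs. -/
noncomputable def familySize {V ι : Type*} [Fintype ι] (F : ι → SimpleGraph V) : ℕ :=
  ∑ i, (F i).edgeSet.ncard

theorem IsUncovered.symm {V ι : Type*} {G : SimpleGraph V} {F : ι → SimpleGraph V} {x y : V} (h : G.IsUncovered F x y) : G.IsUncovered F y x :=
  ⟨h.1.symm, fun i hi => h.2 i hi.symm⟩

theorem ncard_edgeSet_sup_edge {V : Type*} [Finite V] {H : SimpleGraph V} {x y : V} (hne : x ≠ y) (h : ¬ H.Adj x y) :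
    (H ⊔ edge x y).edgeSet.ncard = H.edgeSet.ncard + 1 := by
  rw [edgeSet_sup, edgeSet_edge_of_ne hne, Set.union_singleton,
    Set.ncard_insert_of_notMem (by simpa using h) (Set.toFinite _)]

/-- An uncovered edge lies in no other forest, and an edge between two components of `H` closes no
cycle. Taking `H = F i` enlarges the packing; taking `F i` minus an edge gives an exchange. -/
theorem IsForestPacking.update (hF : G.IsForestPacking F) {x y : V} (hxy : G.IsUncovered F x y)
    (i : ι) {H : SimpleGraph V} (hH : H ≤ F i) (hr : ¬ H.Reachable x y) :
    G.IsForestPacking (Function.update F i (H ⊔ edge x y)) := by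
  have hdis : ∀ j, j ≠ i → Disjoint (H ⊔ edge x y) (F j) := by
    intro j hj
    rw [disjoint_sup_left]
    refine ⟨(hF.2 i j hj.symm).mono_left hH, ?_⟩
    rw [disjoint_left]
    intro u v huv huv'
    rw [edge_adj] at huv
    rcases huv.1 with ⟨rfl, rfl⟩ | ⟨rfl, rfl⟩
    · exact hxy.2 j huv'
    · exact hxy.2 j huv'.symm
  constructor
  · intro j
    by_cases hj : j = i
    · subst hj
      simp only [Function.update_self]
      refine ⟨sup_le (hH.trans (hF.1 j).1) ?_, ((hF.1 j).2.anti hH).sup_edge_of_not_reachable hr⟩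
      exact (edge_le_iff _).2 (Or.inr hxy.1)
    · simpa [Function.update_of_ne hj] using hF.1 j
  · intro j l hjl
    by_cases hj : j = i
    · subst hj
      rw [Function.update_self, Function.update_of_ne hjl.symm]
      exact hdis l hjl.symm
    · rw [Function.update_of_ne hj]
      by_cases hl : l = i
      · subst hl
        rw [Function.update_self]
        exact (hdis j hj).symm
      · rw [Function.update_of_ne hl]
        exact hF.2 j l hjl

theorem familySize_update [Fintype ι] (F : ι → SimpleGraph V) (i : ι) (H : SimpleGraph V) :
    familySize (Function.update F i H) + (F i).edgeSet.ncard = familySize F + H.edgeSet.ncard := by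
  unfold familySize
  rw [← Finset.add_sum_erase _ _ (Finset.mem_univ i), ← Finset.add_sum_erase Finset.univ
    (fun j => (F j).edgeSet.ncard) (Finset.mem_univ i), Function.update_self,
    Finset.sum_congr rfl (g := fun j => (F j).edgeSet.ncard)
    (fun j hj => by rw [Function.update_of_ne (Finset.ne_of_mem_erase hj)])]
  ring

theorem IsEdgeExchange.isForestPacking (h : G.IsEdgeExchange F F') (hF : G.IsForestPacking F) :
    G.IsForestPacking F' := by
  obtain ⟨i, x, y, u, v, hxy, -, hr, rfl⟩ := h
  exact hF.update hxy i (deleteEdges_le _) hr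

theorem IsEdgeExchange.familySize_eq [Fintype V] [Fintype ι] (h : G.IsEdgeExchange F F') :
    familySize F' = familySize F := by
  obtain ⟨i, x, y, u, v, hxy, huv, hr, rfl⟩ := h
  have h1 := familySize_update F i ((F i).deleteEdges {s(u, v)} ⊔ edge x y)
  have h2 : ((F i).deleteEdges {s(u, v)} ⊔ edge x y).edgeSet.ncard = (F i).edgeSet.ncard := by
    rw [ncard_edgeSet_sup_edge hxy.1.ne (fun h => hxy.2 i (deleteEdges_le _ h)),
      edgeSet_deleteEdges, Set.ncard_sdiff_singleton_add_one (by simpa using huv) (Set.toFinite _)]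
  omega

/-- Two adjacent vertices of `exchangeGraph G F₀` are the ends of an edge of `G` that is left
uncovered by some family obtained from `F₀` by edge exchanges. -/
def exchangeGraph (G : SimpleGraph V) (F₀ : ι → SimpleGraph V) : SimpleGraph V where
  Adj x y := ∃ F, Relation.ReflTransGen G.IsEdgeExchange F₀ F ∧ G.IsUncovered F x y
  symm := ⟨fun _ _ ⟨F, h, hF⟩ => ⟨F, h, hF.symm⟩⟩
  loopless := ⟨fun _ ⟨_, _, hF⟩ => hF.1.ne rfl⟩

theorem isForestPacking_of_reflTransGen [Fintype V] [Fintype ι] (h : Relation.ReflTransGen G.IsEdgeExchange F₀ F)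
    (hF₀ : G.IsForestPacking F₀) : G.IsForestPacking F ∧ familySize F = familySize F₀ := by
  induction h with
  | refl => exact ⟨hF₀, rfl⟩
  | tail _ hs ih => exact ⟨hs.isForestPacking ih.1, hs.familySize_eq.trans ih.2⟩

theorem reachable_of_isUncovered [Fintype V] [Fintype ι] (hF : G.IsForestPacking F)
    (hmax : ∀ F' : ι → SimpleGraph V, G.IsForestPacking F' → familySize F' ≤ familySize F)
    {x y : V} (hxy : G.IsUncovered F x y) (i : ι) : (F i).Reachable x y := by
  by_contra hr
  have h1 := hmax _ (hF.update hxy i le_rfl hr)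
  have h2 := familySize_update F i (F i ⊔ edge x y)
  rw [ncard_edgeSet_sup_edge hxy.1.ne (hxy.2 i)] at h2
  omega

theorem IsAcyclic.not_reachable_deleteEdges {V : Type*} {H : SimpleGraph V} (hH : H.IsAcyclic) {x y u v : V}
    {p : H.Walk x y} (hp : p.IsPath) (he : s(u, v) ∈ p.edges) :
    ¬ (H.deleteEdges {s(u, v)}).Reachable x y := by
  classical
  rw [reachable_deleteEdges_iff_exists_walk]
  rintro ⟨q, hq⟩
  have h := (hH.subsingleton_path x y).elim ⟨p, hp⟩ ⟨q.bypass, q.bypass_isPath⟩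
  have h' : p = q.bypass := congrArg Subtype.val h
  exact hq (q.edges_bypass_subset_edges (h' ▸ he))

/-- Exchanges preserve the total size, so `F` is also maximum and the `i`-th forest joins `x` to `y`
by a path. Any edge of this path may be exchanged for `xy` and is then uncovered, so the whole path
lies in the exchange graph. -/
theorem reachable_inf_exchangeGraph_of_isUncovered [Fintype V] [Fintype ι]
    (hF₀ : G.IsForestPacking F₀)
    (hmax : ∀ F' : ι → SimpleGraph V, G.IsForestPacking F' → familySize F' ≤ familySize F₀)
    (hF : Relation.ReflTransGen G.IsEdgeExchange F₀ F)
    {x y : V} (hxy : G.IsUncovered F x y) (i : ι) :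
    (F i ⊓ G.exchangeGraph F₀).Reachable x y := by
  obtain ⟨hFp, hsize⟩ := isForestPacking_of_reflTransGen hF hF₀
  obtain ⟨p, hp⟩ := (reachable_of_isUncovered hFp (fun F' h => hsize ▸ hmax F' h) hxy
    i).exists_isPath
  refine ⟨p.transfer _ ?_⟩
  intro e he
  induction e with
  | h u v =>
  have huv : (F i).Adj u v := p.adj_of_mem_edges he
  refine ⟨huv, Function.update F i ((F i).deleteEdges {s(u, v)} ⊔ edge x y),
    hF.tail ⟨i, x, y, u, v, hxy, huv, (hFp.1 i).2.not_reachable_deleteEdges hp he, rfl⟩,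
    (hFp.1 i).1 huv, ?_⟩
  intro j
  by_cases hj : j = i
  · subst hj
    rw [Function.update_self, sup_adj, edge_adj]
    rintro (h | ⟨⟨rfl, rfl⟩ | ⟨rfl, rfl⟩, -⟩)
    · simp at h
    · exact hxy.2 j huv
    · exact hxy.2 j huv.symm
  · rw [Function.update_of_ne hj]
    exact fun h => disjoint_left.1 (hFp.2 i j (Ne.symm hj)) u v huv h

theorem Reachable.of_forall_adj {V : Type*} {H H' : SimpleGraph V} (h : ∀ x y, H.Adj x y → H'.Reachable x y)
    {x y : V} (hxy : H.Reachable x y) : H'.Reachable x y := by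
  obtain ⟨p⟩ := hxy
  induction p with
  | nil => rfl
  | cons hadj _ ih => exact (h _ _ hadj).trans ih

/-- Undoing one exchange loses only the edge that it inserted. That edge was uncovered before, so
its ends were already joined inside the exchange graph by the old forest. -/
theorem reachable_inf_exchangeGraph_of_reflTransGen [Fintype V] [Fintype ι]
    (hF₀ : G.IsForestPacking F₀)
    (hmax : ∀ F' : ι → SimpleGraph V, G.IsForestPacking F' → familySize F' ≤ familySize F₀)
    (hF : Relation.ReflTransGen G.IsEdgeExchange F₀ F) (i : ι) {x y : V}
    (hxy : (F i ⊓ G.exchangeGraph F₀).Reachable x y) :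
    (F₀ i ⊓ G.exchangeGraph F₀).Reachable x y := by
  induction hF generalizing x y with
  | refl => exact hxy
  | @tail F F' hF hs ih =>
    apply ih
    refine Reachable.of_forall_adj ?_ hxy
    intro a b hab
    obtain ⟨j, c, d, u, v, hcd, -, -, rfl⟩ := hs
    obtain ⟨hab, hab'⟩ := hab
    by_cases hj : i = j
    · subst hj
      rw [Function.update_self, sup_adj, edge_adj] at hab
      rcases hab with hab | ⟨⟨rfl, rfl⟩ | ⟨rfl, rfl⟩, -⟩
      · exact Adj.reachable ⟨deleteEdges_le _ hab, hab'⟩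
      · exact reachable_inf_exchangeGraph_of_isUncovered hF₀ hmax hF hcd i
      · exact (reachable_inf_exchangeGraph_of_isUncovered hF₀ hmax hF hcd i).symm
    · rw [Function.update_of_ne hj] at hab
      exact Adj.reachable ⟨hab, hab'⟩

theorem reachable_inf_exchangeGraph_iff [Fintype V] [Fintype ι]
    (hF₀ : G.IsForestPacking F₀)
    (hmax : ∀ F' : ι → SimpleGraph V, G.IsForestPacking F' → familySize F' ≤ familySize F₀) (i : ι) (x y : V) :
    (F₀ i ⊓ G.exchangeGraph F₀).Reachable x y ↔ (G.exchangeGraph F₀).Reachable x y := by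
  refine ⟨fun h => h.mono inf_le_right, fun h => Reachable.of_forall_adj ?_ h⟩
  rintro a b ⟨F, hF, hab⟩
  exact reachable_inf_exchangeGraph_of_reflTransGen hF₀ hmax hF i
    (reachable_inf_exchangeGraph_of_isUncovered hF₀ hmax hF hab i)

end Exchange

/-- The edges of `G` that join different connected components of `K`. -/
def crossGraph {V : Type*} (G K : SimpleGraph V) : SimpleGraph V where
  Adj x y := G.Adj x y ∧ ¬ K.Reachable x y
  symm := ⟨fun _ _ h => ⟨h.1.symm, fun h' => h.2 h'.symm⟩⟩
  loopless := ⟨fun _ h => h.1.ne rfl⟩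

/-- The Nash-Williams–Tutte theorem: if `G` has no `k` edge-disjoint spanning trees, then for some
partition of the vertex set (into the connected components of a graph `K`) fewer than
`k (s - 1)` edges join different parts, where `s` is the number of parts. -/
theorem exists_crossGraph_lt_of_not_isSpanningTreePacking {V : Type*} [Fintype V] [Nonempty V]
    (G : SimpleGraph V) (k : ℕ)
    (h : ¬ ∃ T : Fin k → SimpleGraph V, G.IsSpanningTreePacking T) :
    ∃ K : SimpleGraph V,
      (G.crossGraph K).edgeSet.ncard + 1 + k ≤ k * Nat.card K.ConnectedComponent := by
  classical
  obtain ⟨F, hF, hmax⟩ := Set.exists_max_image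
    {F : Fin k → SimpleGraph V | G.IsForestPacking F} familySize (Set.toFinite _)
    ⟨fun _ => ⊥, fun _ => ⟨bot_le, isAcyclic_bot⟩, fun _ _ _ => disjoint_bot_left⟩
  have hF : G.IsForestPacking F := hF
  set K := G.exchangeGraph F with hK
  refine ⟨K, ?_⟩
  have hreach := reachable_inf_exchangeGraph_iff hF hmax
  set n := Fintype.card V
  set s := Nat.card K.ConnectedComponent
  -- Each restricted forest has exactly the components of `K`, hence `n - s` edges.
  have hinf : ∀ i, (F i ⊓ K).edgeSet.ncard + s = n := by
    intro i
    have h1 := ((hF.1 i).2.anti (inf_le_left : F i ⊓ K ≤ F i)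
      ).ncard_edgeSet_add_card_connectedComponent
    have h2 : (F i ⊓ K).Reachable = K.Reachable := by
      funext x y
      exact propext (hreach i x y)
    have h3 : Nat.card (F i ⊓ K).ConnectedComponent = s := by
      unfold ConnectedComponent
      rw [h2]
      rfl
    omega
  -- An edge between components of `K` is not in `K`, so `F` itself covers it, by a forest edge
  -- outside `K`.
  have hcover : (G.crossGraph K).edgeSet ⊆
      ⋃ i ∈ (Finset.univ : Finset (Fin k)), (F i).edgeSet \ (F i ⊓ K).edgeSet := by
    intro e he
    induction e with
    | h x y =>
    obtain ⟨hxy, hr⟩ : G.Adj x y ∧ ¬ K.Reachable x y := he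
    have hnot : ¬ K.Adj x y := fun h => hr h.reachable
    have hex : ∃ i, (F i).Adj x y := by
      by_contra hne
      push Not at hne
      exact hnot ⟨F, .refl, hxy, hne⟩
    obtain ⟨i, hi⟩ := hex
    simp only [Set.mem_iUnion]
    exact ⟨i, Finset.mem_univ i, hi, fun h => hnot h.2⟩
  have hcross : (G.crossGraph K).edgeSet.ncard ≤
      ∑ i, ((F i).edgeSet \ (F i ⊓ K).edgeSet).ncard :=
    (Set.ncard_le_ncard hcover (Set.toFinite _)).trans (Finset.set_ncard_biUnion_le _ _)
  have hdiff : ∀ i, ((F i).edgeSet \ (F i ⊓ K).edgeSet).ncard + n = (F i).edgeSet.ncard + s := by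
    intro i
    have h1 := Set.ncard_sdiff_add_ncard_of_subset
      (edgeSet_mono (inf_le_left : F i ⊓ K ≤ F i)) (Set.toFinite _)
    have h2 := hinf i
    omega
  have htotal : ∑ i, (F i).edgeSet.ncard + k + 1 ≤ k * n := by
    have hcard := fun i => (hF.1 i).2.ncard_edgeSet_add_card_connectedComponent
    have hpos : ∀ i, 1 ≤ Nat.card (F i).ConnectedComponent := fun i => Nat.card_pos
    -- If all forests were connected they would be `k` edge-disjoint spanning trees. This strict
    -- inequality supplies the final `- 1` in `k(s-1) - 1`.
    have hlt : ∃ i, 1 < Nat.card (F i).ConnectedComponent := by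
      by_contra hne
      push Not at hne
      refine h ⟨F, fun i => ⟨(hF.1 i).1, ?_, (hF.1 i).2⟩, fun i j hij =>
        disjoint_edgeSet.2 (hF.2 i j hij)⟩
      have := (Nat.card_eq_one_iff_unique.1 (le_antisymm (hne i) (hpos i))).1
      exact ⟨fun x y => ConnectedComponent.exact (Subsingleton.elim _ _)⟩
    have h1 : ∑ i : Fin k, 1 < ∑ i, Nat.card (F i).ConnectedComponent :=
      Finset.sum_lt_sum (fun i _ => hpos i) (by simpa using hlt)
    have h2 : ∑ i, (F i).edgeSet.ncard + ∑ i, Nat.card (F i).ConnectedComponent = k * n := by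
      rw [← Finset.sum_add_distrib, Finset.sum_congr rfl (fun i _ => hcard i)]
      simp [n]
    rw [Finset.sum_const, Finset.card_univ, Fintype.card_fin, smul_eq_mul, mul_one] at h1
    omega
  have hsum : ∑ i, ((F i).edgeSet \ (F i ⊓ K).edgeSet).ncard + k * n =
      ∑ i, (F i).edgeSet.ncard + k * s := by
    have := Finset.sum_congr rfl (fun i (_ : i ∈ (Finset.univ : Finset (Fin k))) => hdiff i)
    simpa [Finset.sum_add_distrib] using this
  omega

end SimpleGraph

/-! ### Distance levels below half the girth -/

namespace SimpleGraph

section Girth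

variable {V : Type*} {H : SimpleGraph V}

/-- Two different paths with the same ends contain a cycle. -/
theorem egirth_le_of_isPath_ne {x y : V} {p q : H.Walk x y} (hp : p.IsPath) (hq : q.IsPath)
    (hne : p ≠ q) : H.egirth ≤ (p.length + q.length : ℕ) := by
  classical
  set E : Set (Sym2 V) := {e | e ∈ p.edges ∨ e ∈ q.edges}
  have hS : fromEdgeSet E ≤ H := by
    intro a b hab
    rw [fromEdgeSet_adj] at hab
    rcases hab.1 with h | h
    · exact p.adj_of_mem_edges h
    · exact q.adj_of_mem_edges h
  have hmem : ∀ e ∈ E, e ∈ H.edgeSet → e ∈ (fromEdgeSet E).edgeSet := by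
    intro e he he'
    rw [edgeSet_fromEdgeSet]
    exact ⟨he, H.not_isDiag_of_mem_edgeSet he'⟩
  have hpE : ∀ e ∈ p.edges, e ∈ (fromEdgeSet E).edgeSet :=
    fun e he => hmem e (Or.inl he) (p.edges_subset_edgeSet he)
  have hqE : ∀ e ∈ q.edges, e ∈ (fromEdgeSet E).edgeSet :=
    fun e he => hmem e (Or.inr he) (q.edges_subset_edgeSet he)
  have hcyc : ¬ (fromEdgeSet E).IsAcyclic := by
    intro hac
    have h := (hac.subsingleton_path x y).elim ⟨p.transfer _ hpE, hp.transfer hpE⟩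
      ⟨q.transfer _ hqE, hq.transfer hqE⟩
    have h1 : p.transfer _ hpE = q.transfer _ hqE := congrArg Subtype.val h
    apply hne
    apply Walk.ext_support
    have := congrArg Walk.support h1
    simpa using this
  obtain ⟨a, c, hc, -⟩ := exists_egirth_eq_length.2 hcyc
  -- The edges of a cycle are distinct and here all come from `p` or `q`.
  have hlen : c.length ≤ p.length + q.length := by
    rw [← Walk.length_edges, ← Walk.length_edges, ← Walk.length_edges, ← List.length_append,
      ← List.toFinset_card_of_nodup hc.1.1.edges_nodup]
    refine le_trans (Finset.card_le_card ?_) (List.toFinset_card_le _)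
    intro e he
    have he' := c.edges_subset_edgeSet (List.mem_toFinset.1 he)
    rw [edgeSet_fromEdgeSet] at he'
    have h : e ∈ p.edges ∨ e ∈ q.edges := he'.1
    simpa using h
  calc H.egirth ≤ (fromEdgeSet E).egirth := egirth_anti hS
    _ ≤ c.length := egirth_le_length hc
    _ ≤ _ := by exact_mod_cast hlen

/-- Shortest paths to `y` and `z`, each extended by `x`, are two different paths from `u` to `x`.
Their extensions remain paths because a shortest path passing through `x` would put its end farther
from `u` than `x`. -/
theorem dist_add_dist_of_adj_of_ne {t : ℕ} (ht : (2 * t : ℕ) < H.egirth) {u x y z : V}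
    (hy : H.Reachable u y) (hz : H.Reachable u z) (hxy : H.Adj y x) (hxz : H.Adj z x)
    (hyx : H.dist u y ≤ H.dist u x) (hzx : H.dist u z ≤ H.dist u x) (hne : y ≠ z) :
    2 * t < H.dist u y + H.dist u z + 2 := by
  classical
  have key : ∀ w, H.Reachable u w → H.Adj w x → H.dist u w ≤ H.dist u x →
      ∃ p : H.Walk u x, p.IsPath ∧ p.length = H.dist u w + 1 ∧ p.penultimate = w := by
    intro w hw hwx hle
    obtain ⟨p, hp, hlen⟩ := hw.exists_path_of_dist
    have hx : x ∉ p.support := by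
      intro hx
      have h1 := p.length_takeUntil_lt_length hx hwx.ne'
      have h2 := dist_le (p.takeUntil x hx)
      omega
    exact ⟨p.concat hwx, hp.concat hx hwx, by rw [Walk.length_concat, hlen], by simp⟩
  obtain ⟨p, hp, hpl, hpp⟩ := key y hy hxy hyx
  obtain ⟨q, hq, hql, hqp⟩ := key z hz hxz hzx
  have hpq : p ≠ q := by
    rintro rfl
    exact hne (hpp.symm.trans hqp)
  have := ht.trans_le (egirth_le_of_isPath_ne hp hq hpq)
  have : 2 * t < p.length + q.length := by exact_mod_cast this
  omega

end Girth

section Levels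

variable {V : Type*} [Fintype V] [DecidableEq V]

open Classical in
/-- The vertices at distance exactly `j` from `u`. -/
noncomputable def distLevel (H : SimpleGraph V) (u : V) (j : ℕ) : Finset V :=
  {x | H.Reachable u x ∧ H.dist u x = j}

theorem mem_distLevel {H : SimpleGraph V} {u x : V} {j : ℕ} :
    x ∈ H.distLevel u j ↔ H.Reachable u x ∧ H.dist u x = j := by
  simp [distLevel]

theorem self_mem_distLevel_zero (H : SimpleGraph V) (u : V) : u ∈ H.distLevel u 0 :=
  mem_distLevel.2 ⟨.rfl, dist_self⟩

variable {H : SimpleGraph V} [DecidableRel H.Adj]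

theorem degree_le_card_distLevel_one (u : V) : H.degree u ≤ (H.distLevel u 1).card := by
  rw [← card_neighborFinset_eq_degree]
  refine Finset.card_le_card fun x hx => ?_
  have hx : H.Adj u x := by simpa using hx
  exact mem_distLevel.2 ⟨hx.reachable, dist_eq_one_iff_adj.2 hx⟩

/-- Within half the girth, every vertex of a distance level has at most one neighbour outside of
the next level, and the sets of neighbours in the next level are disjoint. -/
theorem sum_degree_sub_one_le_card_distLevel {t : ℕ} (ht : (2 * t : ℕ) < H.egirth) (u : V) {j : ℕ}
    (hjt : j + 1 ≤ t) :
    ∑ x ∈ H.distLevel u j, (H.degree x - 1) ≤ (H.distLevel u (j + 1)).card := by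
  set S := H.distLevel u (j + 1)
  have hdisj : (H.distLevel u j : Set V).PairwiseDisjoint (fun x => H.neighborFinset x ∩ S) := by
    intro y hy z hz hne
    rw [Function.onFun, Finset.disjoint_left]
    intro x hxy hxz
    rw [Finset.mem_inter, mem_neighborFinset] at hxy hxz
    obtain ⟨hy1, hy2⟩ := mem_distLevel.1 (Finset.mem_coe.1 hy)
    obtain ⟨hz1, hz2⟩ := mem_distLevel.1 (Finset.mem_coe.1 hz)
    obtain ⟨-, hx2⟩ := mem_distLevel.1 hxy.2
    have := dist_add_dist_of_adj_of_ne ht hy1 hz1 hxy.1 hxz.1 (by omega) (by omega) hne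
    omega
  have hle : ∀ x ∈ H.distLevel u j, H.degree x - 1 ≤ (H.neighborFinset x ∩ S).card := by
    intro x hx
    obtain ⟨hx1, hx2⟩ := mem_distLevel.1 hx
    have hnear : ∀ y ∈ H.neighborFinset x \ S, H.Reachable u y ∧ H.Adj y x ∧ H.dist u y ≤ j := by
      intro y hy
      rw [Finset.mem_sdiff, mem_neighborFinset] at hy
      have hr := hx1.trans hy.1.reachable
      refine ⟨hr, hy.1.symm, ?_⟩
      obtain ⟨p, hp⟩ := hx1.exists_walk_length_eq_dist
      have h1 := dist_le (p.concat hy.1)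
      rw [Walk.length_concat] at h1
      have h2 : H.dist u y ≠ j + 1 := fun h => hy.2 (mem_distLevel.2 ⟨hr, h⟩)
      omega
    have hone : (H.neighborFinset x \ S).card ≤ 1 := by
      rw [Finset.card_le_one]
      intro y hy z hz
      by_contra hne
      obtain ⟨hy1, hy2, hy3⟩ := hnear y hy
      obtain ⟨hz1, hz2, hz3⟩ := hnear z hz
      have := dist_add_dist_of_adj_of_ne ht hy1 hz1 hy2 hz2 (by omega) (by omega) hne
      omega
    have h := Finset.card_sdiff_add_card_inter (H.neighborFinset x) S
    rw [card_neighborFinset_eq_degree] at h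
    omega
  calc ∑ x ∈ H.distLevel u j, (H.degree x - 1)
      ≤ ∑ x ∈ H.distLevel u j, (H.neighborFinset x ∩ S).card := Finset.sum_le_sum hle
    _ = ((H.distLevel u j).biUnion fun x => H.neighborFinset x ∩ S).card :=
        (Finset.card_biUnion fun x hx y hy h => hdisj hx hy h).symm
    _ ≤ S.card := Finset.card_le_card
        (Finset.biUnion_subset.2 fun x _ => Finset.inter_subset_right)

end Levels

/-- The number of neighbours of `x` outside of `X`. -/
def outDegree {V : Type*} [Fintype V] [DecidableEq V] (G : SimpleGraph V) [DecidableRel G.Adj]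
    (X : Finset V) (x : V) : ℕ :=
  (G.neighborFinset x \ X).card

section LevelGrowth

open Finset

/-- Before losses, level 2 exceeds its target `m 2` by `D`, which is the whole budget for losses.
The unspent part of the budget is carried along as a surplus. -/
theorem le_of_growth_with_losses {t D : ℕ} {N loss m : ℕ → ℕ} (hD : 1 ≤ D)
    (hN : ∀ j, 1 ≤ j → j + 1 ≤ t → D * N j ≤ N (j + 1) + loss j)
    (hloss : ∑ j ∈ Ico 1 t, loss j ≤ D)
    (hm₂ : m 2 + D ≤ D * N 1) (hm : ∀ j, 2 ≤ j → m (j + 1) ≤ D * m j)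
    {j : ℕ} (hj : 2 ≤ j) (hjt : j ≤ t) : m j ≤ N j := by
  have key : m j + D ≤ N j + ∑ i ∈ Ico 1 j, loss i := by
    induction j, hj using Nat.le_induction with
    | base =>
      have := hN 1 le_rfl hjt
      simp only [Nat.Ico_succ_singleton, sum_singleton]
      exact hm₂.trans this
    | succ j hj ih =>
      have h1 := ih (by omega)
      have h2 := hN j (by omega) hjt
      have h3 := hm j hj
      have h4 : ∑ i ∈ Ico 1 j, loss i ≤ D :=
        (sum_le_sum_of_subset (Ico_subset_Ico_right (by omega))).trans hloss
      rw [sum_Ico_succ_top (by omega)]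
      obtain ⟨r, hr⟩ := Nat.exists_eq_add_of_le h4
      have h5 : m j + r ≤ N j := by omega
      have h6 : D * m j + D * r ≤ D * N j := by rw [← mul_add]; exact Nat.mul_le_mul_left D h5
      -- Passing to the next level multiplies the surplus `r` by `D ≥ 1`, so it can still pay for
      -- all later losses.
      have h7 : r ≤ D * r := Nat.le_mul_of_pos_left r hD
      omega
  have h4 : ∑ i ∈ Ico 1 j, loss i ≤ D :=
    (sum_le_sum_of_subset (Ico_subset_Ico_right hjt)).trans hloss
  omega

variable {V : Type*} [DecidableEq V]

/-- Disjoint levels inside `X` charge disjoint parts of its edge boundary, so their total loss stays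
within `D`. -/
theorem card_add_card_add_sum_le_card {t D : ℕ} {B : ℕ → Finset V} {X : Finset V} {m : ℕ → ℕ}
    (out : V → ℕ) (hD : 1 ≤ D) (ht : 1 ≤ t)
    (hdisj : ∀ i j, i ≤ t → j ≤ t → i ≠ j → Disjoint (B i) (B j))
    (hX : ∀ j, j ≤ t → B j ⊆ X)
    (hB : ∀ j, 1 ≤ j → j + 1 ≤ t → D * (B j).card ≤ (B (j + 1)).card + ∑ x ∈ B j, out x)
    (hout : ∑ x ∈ X, out x ≤ D)
    (hm₂ : m 2 + D ≤ D * (B 1).card) (hm : ∀ j, 2 ≤ j → m (j + 1) ≤ D * m j) :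
    (B 0).card + (B 1).card + ∑ j ∈ Icc 2 t, m j ≤ X.card := by
  have hloss : ∑ j ∈ Ico 1 t, ∑ x ∈ B j, out x ≤ D := by
    rw [← sum_biUnion]
    · refine (sum_le_sum_of_subset (biUnion_subset.2 fun j hj => ?_)).trans hout
      exact hX j (mem_Ico.1 hj).2.le
    · intro i hi j hj hij
      exact hdisj i j (mem_Ico.1 hi).2.le (mem_Ico.1 hj).2.le hij
  have hle : ∀ j ∈ Icc 2 t, m j ≤ (B j).card := fun j hj =>
    le_of_growth_with_losses (N := fun j => (B j).card) hD hB hloss hm₂ hm (mem_Icc.1 hj).1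
      (mem_Icc.1 hj).2
  have hsum : ∑ j ∈ range (t + 1), (B j).card ≤ X.card := by
    rw [← card_biUnion]
    · refine card_le_card (biUnion_subset.2 fun j hj => hX j ?_)
      have := mem_range.1 hj
      omega
    · intro i hi j hj hij
      have := mem_range.1 hi
      have := mem_range.1 hj
      exact hdisj i j (by omega) (by omega) hij
  have hsplit : ∑ j ∈ range (t + 1), (B j).card =
      (B 0).card + (B 1).card + ∑ j ∈ Icc 2 t, (B j).card := by
    rw [show Icc 2 t = Ico 2 (t + 1) from rfl, range_eq_Ico,
      sum_eq_sum_Ico_succ_bot (by omega), sum_eq_sum_Ico_succ_bot (by omega), ← add_assoc]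
  have := sum_le_sum hle
  omega

end LevelGrowth

end SimpleGraph

/-! ### The Moore-type bound for sets with small edge boundary -/

namespace SimpleGraph

open Finset

variable {V : Type*} [Fintype V] [DecidableEq V] {G : SimpleGraph V} [DecidableRel G.Adj]
  {X : Finset V} {D : ℕ}

theorem degree_le_card_inter_add_outDegree (x : V) :
    G.degree x = (G.neighborFinset x ∩ X).card + G.outDegree X x := by
  rw [outDegree, card_inter_add_card_sdiff, card_neighborFinset_eq_degree]

/-- A nonempty set with a small edge boundary has a vertex without neighbours outside. -/
theorem exists_outDegree_eq_zero (hX : X.Nonempty) (hdeg : ∀ x, D + 1 ≤ G.degree x)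
    (hout : ∑ x ∈ X, G.outDegree X x ≤ D) : ∃ u ∈ X, G.outDegree X u = 0 := by
  by_contra! hne
  have h1 : X.card ≤ D := by
    refine le_trans ?_ hout
    rw [card_eq_sum_ones]
    exact sum_le_sum fun x hx => Nat.one_le_iff_ne_zero.2 (hne x hx)
  have h2 : ∀ x ∈ X, D + 2 ≤ X.card + G.outDegree X x := by
    intro x hx
    have h3 : (G.neighborFinset x ∩ X).card + 1 ≤ X.card := by
      refine card_lt_card ⟨inter_subset_right, fun h => ?_⟩
      have := h hx
      simp at this
    have h4 := degree_le_card_inter_add_outDegree (G := G) (X := X) x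
    have h5 := hdeg x
    omega
  have h3 := sum_le_sum h2
  rw [sum_const, smul_eq_mul] at h3
  have h4 : 1 ≤ X.card := hX.card_pos
  rw [sum_add_distrib, sum_const, smul_eq_mul] at h3
  -- With `c = |X|` and `1 ≤ c ≤ D`, summing gives `c(D + 2 - c) ≤ D`, which fails on this whole
  -- range.
  nlinarith

/-- The edges of `G` inside `X`, except for the edge between `u` and `v`. -/
def insideGraph (G : SimpleGraph V) (X : Finset V) (u v : V) : SimpleGraph V where
  Adj x y := (G.Adj x y ∧ x ∈ X ∧ y ∈ X) ∧ s(x, y) ≠ s(u, v)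
  symm := ⟨fun _ _ h => ⟨⟨h.1.1.symm, h.1.2.2, h.1.2.1⟩, by rw [Sym2.eq_swap]; exact h.2⟩⟩
  loopless := ⟨fun _ h => h.1.1.ne rfl⟩

instance (u v : V) : DecidableRel (G.insideGraph X u v).Adj :=
  fun x y => inferInstanceAs (Decidable ((G.Adj x y ∧ x ∈ X ∧ y ∈ X) ∧ s(x, y) ≠ s(u, v)))

theorem insideGraph_adj {V : Type*} {G : SimpleGraph V} {X : Finset V} {u v x y : V} :
    (G.insideGraph X u v).Adj x y ↔ (G.Adj x y ∧ x ∈ X ∧ y ∈ X) ∧ s(x, y) ≠ s(u, v) := Iff.rfl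

theorem insideGraph_le {V : Type*} {G : SimpleGraph V} {X : Finset V} (u v : V) : G.insideGraph X u v ≤ G := fun _ _ h => h.1.1

theorem mem_of_reachable_insideGraph {V : Type*} {G : SimpleGraph V} {X : Finset V} {u v w x : V} (hw : w ∈ X)
    (h : (G.insideGraph X u v).Reachable w x) : x ∈ X := by
  obtain ⟨p⟩ := h
  induction p with
  | nil => exact hw
  | cons hadj _ ih => exact ih hadj.1.2.2

theorem degree_insideGraph {u v x : V} (hx : x ∈ X) (hxu : x ≠ u) (hxv : x ≠ v) :
    (G.insideGraph X u v).degree x + G.outDegree X x = G.degree x := by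
  rw [degree_le_card_inter_add_outDegree (G := G) (X := X) x, ← card_neighborFinset_eq_degree]
  congr 2
  ext y
  simp only [mem_neighborFinset, insideGraph_adj, mem_inter]
  constructor
  · exact fun h => ⟨h.1.1, h.1.2.2⟩
  · refine fun h => ⟨⟨h.1, hx, h.2⟩, fun h' => ?_⟩
    rcases Sym2.eq_iff.1 h' with ⟨h1, -⟩ | ⟨h1, -⟩
    · exact hxu h1
    · exact hxv h1

theorem degree_insideGraph_left {u v : V} (hu : u ∈ X) :
    G.degree u ≤ (G.insideGraph X u v).degree u + 1 + G.outDegree X u := by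
  rw [degree_le_card_inter_add_outDegree (G := G) (X := X) u, ← card_neighborFinset_eq_degree]
  gcongr
  rw [← card_singleton v]
  refine le_trans (card_le_card fun y hy => ?_) (card_union_le _ _)
  simp only [mem_inter, mem_neighborFinset] at hy
  simp only [mem_union, mem_neighborFinset, insideGraph_adj, mem_singleton]
  by_cases h : y = v
  · exact Or.inr h
  · refine Or.inl ⟨⟨hy.1, hu, hy.2⟩, fun h' => ?_⟩
    rcases Sym2.eq_iff.1 h' with ⟨-, h1⟩ | ⟨h1, h2⟩
    · exact h h1
    · exact hy.1.ne h2.symm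

theorem insideGraph_comm {V : Type*} {G : SimpleGraph V} {X : Finset V} (u v : V) : G.insideGraph X u v = G.insideGraph X v u := by
  ext x y
  simp only [insideGraph, Sym2.eq_swap (a := u)]

theorem degree_insideGraph_right {u v : V} (hv : v ∈ X) :
    G.degree v ≤ (G.insideGraph X u v).degree v + 1 + G.outDegree X v := by
  have h := degree_insideGraph_left (G := G) (X := X) (u := v) (v := u) hv
  convert h using 4
  exact insideGraph_comm u v

theorem degree_insideGraph_self {u x : V} (hx : x ∈ X) :
    (G.insideGraph X u u).degree x + G.outDegree X x = G.degree x := by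
  rw [degree_le_card_inter_add_outDegree (G := G) (X := X) x, ← card_neighborFinset_eq_degree]
  congr 2
  ext y
  simp only [mem_neighborFinset, insideGraph_adj, mem_inter]
  constructor
  · exact fun h => ⟨h.1.1, h.1.2.2⟩
  · refine fun h => ⟨⟨h.1, hx, h.2⟩, fun h' => ?_⟩
    rcases Sym2.eq_iff.1 h' with ⟨h1, h2⟩ | ⟨h1, h2⟩ <;> exact h.1.ne (h1.trans h2.symm)

theorem disjoint_distLevel {H : SimpleGraph V} (u : V) {i j : ℕ} (hij : i ≠ j) :
    Disjoint (H.distLevel u i) (H.distLevel u j) := by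
  rw [Finset.disjoint_left]
  intro x hi hj
  exact hij ((mem_distLevel.1 hi).2.symm.trans (mem_distLevel.1 hj).2)

theorem mul_card_le_of_forall_degree {H : SimpleGraph V} [DecidableRel H.Adj] {t : ℕ}
    (ht : (2 * t : ℕ) < H.egirth) (u : V) {j : ℕ} (hjt : j + 1 ≤ t)
    (hdeg : ∀ x ∈ H.distLevel u j, D + 1 ≤ H.degree x + G.outDegree X x) :
    D * (H.distLevel u j).card ≤
      (H.distLevel u (j + 1)).card + ∑ x ∈ H.distLevel u j, G.outDegree X x := by
  refine le_trans ?_ (Nat.add_le_add_right (sum_degree_sub_one_le_card_distLevel ht u hjt) _)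
  rw [← sum_add_distrib, mul_comm, ← smul_eq_mul, ← sum_const]
  refine sum_le_sum fun x hx => ?_
  have := hdeg x hx
  omega

theorem odd_girth_bound_le_card {t : ℕ} (ht : 1 ≤ t) (hg : (2 * t : ℕ) < G.egirth) (hD : 1 ≤ D)
    (hX : X.Nonempty) (hdeg : ∀ x, D + 1 ≤ G.degree x)
    (hout : ∑ x ∈ X, G.outDegree X x ≤ D) :
    1 + (D + 1) + ∑ i ∈ Icc 2 t, D ^ i ≤ X.card := by
  obtain ⟨u, huX, hu⟩ := exists_outDegree_eq_zero hX hdeg hout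
  -- With both ends equal to `u` no edge is removed: `H` is just `G` inside `X`.
  set H := G.insideGraph X u u
  have hgH : (2 * t : ℕ) < H.egirth := hg.trans_le (egirth_anti (insideGraph_le u u))
  have hB0 : 1 ≤ (H.distLevel u 0).card := card_pos.2 ⟨u, H.self_mem_distLevel_zero u⟩
  have hB1 : D + 1 ≤ (H.distLevel u 1).card := by
    have h1 := degree_le_card_distLevel_one (H := H) u
    have h2 : H.degree u + _ = _ := degree_insideGraph_self (G := G) (u := u) huX
    have h3 := hdeg u
    omega
  have hmem : ∀ j, ∀ x ∈ H.distLevel u j, x ∈ X := fun j x hx =>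
    mem_of_reachable_insideGraph huX (mem_distLevel.1 hx).1
  have h := card_add_card_add_sum_le_card (t := t) (D := D) (B := H.distLevel u) (X := X)
    (m := fun j => D ^ j) (G.outDegree X) hD ht (fun i j _ _ hij => disjoint_distLevel u hij)
    (fun j _ x hx => hmem j x hx)
    (fun j hj hjt => mul_card_le_of_forall_degree hgH u hjt fun x hx => by
      rw [degree_insideGraph_self (hmem j x hx)]
      exact hdeg x)
    hout (by nlinarith) (fun j _ => (pow_succ' D j).le)
  omega

/-- Together with the removed edge `uv`, a path inside from `u` to `v` closes a cycle. -/
theorem lt_length_of_walk_insideGraph {V : Type*} [DecidableEq V] {G : SimpleGraph V}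
    {X : Finset V} {t : ℕ} {u v : V} (hg : (2 * t + 1 : ℕ) < G.egirth)
    (huv : G.Adj u v) (p : (G.insideGraph X u v).Walk u v) : 2 * t < p.length := by
  have hne : (p.bypass.mapLe (insideGraph_le u v)) ≠ Walk.cons huv .nil := by
    intro h
    have h1 := congrArg Walk.edges h
    rw [Walk.edges_mapLe_eq_edges] at h1
    have h2 : s(u, v) ∈ p.bypass.edges := by simp [h1]
    have h3 := p.bypass.adj_of_mem_edges h2
    exact h3.2 rfl
  have h := hg.trans_le (egirth_le_of_isPath_ne
    ((Walk.isPath_mapLe (insideGraph_le u v)).2 p.bypass_isPath) (by simp [huv.ne]) hne)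
  have h : 2 * t + 1 < (p.bypass.mapLe (insideGraph_le u v)).length + (Walk.cons huv .nil).length :=
    by exact_mod_cast h
  have h2 := p.length_bypass_le_length
  simp at h
  omega

/-- The summand is `2D^j - D^(j-1)`, so all but the top power survive with coefficient one. -/
theorem sum_two_mul_pow_sub_pow (D : ℕ) (hD : 1 ≤ D) (t : ℕ) (ht : 1 ≤ t) :
    2 * D + ∑ j ∈ Icc 2 t, D ^ (j - 1) * (2 * D - 1) =
      2 * D ^ t + ∑ i ∈ Icc 1 (t - 1), D ^ i := by
  induction t, ht using Nat.le_induction with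
  | base => simp
  | succ t ht ih =>
    obtain ⟨s, rfl⟩ := Nat.exists_eq_add_of_le' ht
    obtain ⟨d, rfl⟩ := Nat.exists_eq_add_of_le' hD
    rw [sum_Icc_succ_top (by omega), ← add_assoc, ih]
    simp only [Nat.add_sub_cancel]
    rw [sum_Icc_succ_top (by omega), show 2 * (d + 1) - 1 = 2 * d + 1 by omega]
    ring

theorem even_girth_bound_le_card {t : ℕ} (ht : 1 ≤ t) (hg : (2 * t + 1 : ℕ) < G.egirth)
    (hD : 1 ≤ D) (hX : X.Nonempty) (hdeg : ∀ x, D + 1 ≤ G.degree x)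
    (hout : ∑ x ∈ X, G.outDegree X x ≤ D) :
    2 + 2 * D ^ t + ∑ i ∈ Icc 1 (t - 1), D ^ i ≤ X.card := by
  obtain ⟨u, huX, hu⟩ := exists_outDegree_eq_zero hX hdeg hout
  have hsub : G.neighborFinset u ⊆ X := by
    rw [outDegree, card_eq_zero, sdiff_eq_empty_iff_subset] at hu
    exact hu
  -- All of the at least `D + 1` neighbours of `u` lie in `X`, and they cannot all have an edge out
  -- of `X`, since only `D` such edges exist. The levels are then grown from both ends of `uv`.
  obtain ⟨v, huv, hv⟩ : ∃ v, G.Adj u v ∧ G.outDegree X v = 0 := by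
    by_contra! hne
    have h1 : (G.neighborFinset u).card ≤ ∑ x ∈ G.neighborFinset u, G.outDegree X x := by
      rw [card_eq_sum_ones]
      exact sum_le_sum fun x hx => Nat.one_le_iff_ne_zero.2 (hne x (by simpa using hx))
    have h2 := sum_le_sum_of_subset (f := G.outDegree X) hsub
    have h3 := hdeg u
    rw [card_neighborFinset_eq_degree] at h1
    omega
  have hvX : v ∈ X := hsub (by simpa using huv)
  set H := G.insideGraph X u v
  have hgH : (2 * t : ℕ) < H.egirth :=
    lt_trans (by exact_mod_cast Nat.lt_succ_self _)
      (hg.trans_le (egirth_anti (insideGraph_le u v)))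
  have hsides : ∀ i j, i ≤ t → j ≤ t → Disjoint (H.distLevel u i) (H.distLevel v j) := by
    intro i j hi hj
    rw [Finset.disjoint_left]
    intro x hxu hxv
    obtain ⟨hu1, hu2⟩ := mem_distLevel.1 hxu
    obtain ⟨hv1, hv2⟩ := mem_distLevel.1 hxv
    obtain ⟨p, hp⟩ := hu1.exists_walk_length_eq_dist
    obtain ⟨q, hq⟩ := hv1.exists_walk_length_eq_dist
    have h := lt_length_of_walk_insideGraph hg huv (p.append q.reverse)
    rw [Walk.length_append, Walk.length_reverse] at h
    omega
  have hmemu : ∀ j, ∀ x ∈ H.distLevel u j, x ∈ X := fun j x hx =>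
    mem_of_reachable_insideGraph huX (mem_distLevel.1 hx).1
  have hmemv : ∀ j, ∀ x ∈ H.distLevel v j, x ∈ X := fun j x hx =>
    mem_of_reachable_insideGraph hvX (mem_distLevel.1 hx).1
  set B : ℕ → Finset V := fun j => H.distLevel u j ∪ H.distLevel v j with hB
  have hcard : ∀ j, j ≤ t → (B j).card = (H.distLevel u j).card + (H.distLevel v j).card :=
    fun j hj => card_union_of_disjoint (hsides j j hj hj)
  have hB0 : 2 ≤ (B 0).card := by
    have h1 : 1 ≤ (H.distLevel u 0).card := card_pos.2 ⟨u, H.self_mem_distLevel_zero u⟩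
    have h2 : 1 ≤ (H.distLevel v 0).card := card_pos.2 ⟨v, H.self_mem_distLevel_zero v⟩
    rw [hcard 0 (by omega)]
    omega
  have hB1 : 2 * D ≤ (B 1).card := by
    have h1 := degree_le_card_distLevel_one (H := H) u
    have h2 := degree_le_card_distLevel_one (H := H) v
    have h3 : _ ≤ H.degree u + 1 + _ := degree_insideGraph_left (G := G) (v := v) huX
    have h4 : _ ≤ H.degree v + 1 + _ := degree_insideGraph_right (G := G) (u := u) hvX
    have h5 := hdeg u
    have h6 := hdeg v
    rw [hcard 1 ht]
    omega
  have hdegH : ∀ x ∈ X, x ≠ u → x ≠ v → D + 1 ≤ H.degree x + G.outDegree X x := by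
    intro x hx hxu hxv
    rw [degree_insideGraph hx hxu hxv]
    exact hdeg x
  have hgrow : ∀ j, 1 ≤ j → j + 1 ≤ t →
      D * (B j).card ≤ (B (j + 1)).card + ∑ x ∈ B j, G.outDegree X x := by
    intro j hj hjt
    have h1 := mul_card_le_of_forall_degree (G := G) (X := X) (D := D) hgH u hjt fun x hx =>
      hdegH x (hmemu j x hx)
        (fun h => Finset.disjoint_left.1 (disjoint_distLevel u (by omega : j ≠ 0)) hx
          (h ▸ H.self_mem_distLevel_zero u))
        (fun h => Finset.disjoint_left.1 (hsides j 0 (by omega) (by omega)) hx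
          (h ▸ H.self_mem_distLevel_zero v))
    have h2 := mul_card_le_of_forall_degree (G := G) (X := X) (D := D) hgH v hjt fun x hx =>
      hdegH x (hmemv j x hx)
        (fun h => Finset.disjoint_left.1 (hsides 0 j (by omega) (by omega))
          (h ▸ H.self_mem_distLevel_zero u) hx)
        (fun h => Finset.disjoint_left.1 (disjoint_distLevel v (by omega : j ≠ 0)) hx
          (h ▸ H.self_mem_distLevel_zero v))
    rw [hcard j (by omega), hcard (j + 1) hjt, sum_union (hsides j j (by omega) (by omega)),
      mul_add]
    omega
  have hdisj : ∀ i j, i ≤ t → j ≤ t → i ≠ j → Disjoint (B i) (B j) := by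
    intro i j hi hj hij
    simp only [hB, disjoint_union_left, disjoint_union_right]
    exact ⟨⟨disjoint_distLevel u hij, (hsides j i hj hi).symm⟩, hsides i j hi hj,
      disjoint_distLevel v hij⟩
  -- Level 1 has only `2D` guaranteed vertices, so the surplus `D` must come out of `2D²`. This
  -- leaves the target `D(2D-1)` at level 2, and `D^(j-1)(2D-1)` in general.
  have h := card_add_card_add_sum_le_card (t := t) (D := D) (B := B) (X := X)
    (m := fun j => D ^ (j - 1) * (2 * D - 1)) (G.outDegree X) hD ht hdisj
    (fun j _ => union_subset (hmemu j) (hmemv j)) hgrow hout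
    (by
      obtain ⟨d, rfl⟩ := Nat.exists_eq_add_of_le' hD
      rw [show 2 * (d + 1) - 1 = 2 * d + 1 by omega]
      simp only [Nat.add_one_sub_one, pow_one]
      nlinarith)
    (fun j hj => by
      obtain ⟨i, rfl⟩ := Nat.exists_eq_add_of_le' hj
      rw [show i + 2 + 1 - 1 = i + 1 + 1 by omega, show i + 2 - 1 = i + 1 by omega, pow_succ',
        mul_assoc])
  have := sum_two_mul_pow_sub_pow D hD t ht
  omega

/-- A graph of minimum degree at least two has a cycle. -/
theorem not_isAcyclic_of_two_le_minDegree {V : Type*} [Fintype V] {G : SimpleGraph V}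
    [DecidableRel G.Adj] (h : 2 ≤ G.minDegree) : ¬ G.IsAcyclic := by
  intro hac
  have hne : Nonempty V := by
    by_contra hemp
    rw [not_nonempty_iff] at hemp
    simp at h
  have h1 := hac.ncard_edgeSet_add_card_connectedComponent
  have h2 := G.sum_degrees_eq_twice_card_edges
  have h3 : ∑ x : V, 2 ≤ ∑ x, G.degree x :=
    sum_le_sum fun x _ => h.trans (G.minDegree_le_degree x)
  have h4 : 0 < Nat.card G.ConnectedComponent := Nat.card_pos
  rw [Set.ncard_eq_toFinset_card'] at h1
  have h5 : G.edgeSet.toFinset.card = G.edgeFinset.card := rfl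
  rw [sum_const, smul_eq_mul, card_univ] at h3
  omega

/-- A nonempty set of vertices that is left by fewer than `δ` edges has at least
`mooreTypeBound δ g` elements. -/
theorem mooreTypeBound_le_card (hδ : 2 ≤ G.minDegree) (hX : X.Nonempty)
    (hout : ∑ x ∈ X, G.outDegree X x + 1 ≤ G.minDegree) :
    mooreTypeBound G.minDegree G.girth ≤ X.card := by
  have hac := not_isAcyclic_of_two_le_minDegree hδ
  have h3 := three_le_girth hac
  -- `girth` takes the default value `0` on forests; a cycle exists here, so the two notions agree.
  have hgirth : G.egirth = G.girth := by
    rw [girth, ENat.natCast_toNat]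
    simpa using hac
  have hdeg : ∀ x, G.minDegree - 1 + 1 ≤ G.degree x := fun x => by
    have := G.minDegree_le_degree x
    omega
  have key : ∀ m : ℕ, m < G.girth → (m : ℕ∞) < G.egirth := fun m hm => by
    rw [hgirth]
    exact_mod_cast hm
  unfold mooreTypeBound
  simp only
  split_ifs with hodd
  · have := odd_girth_bound_le_card (D := G.minDegree - 1) (t := (G.girth - 1) / 2) (by omega)
      (key _ (by omega)) (by omega) hX hdeg (by omega)
    rwa [Nat.sub_add_cancel (by omega)] at this
  · exact even_girth_bound_le_card (by omega) (key _ (by omega)) (by omega) hX hdeg (by omega)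

end SimpleGraph

/-! ### Second largest and second smallest eigenvalues from a plane of test vectors -/

section Rayleigh

variable {E : Type*} [NormedAddCommGroup E] [InnerProductSpace ℝ E] [FiniteDimensional ℝ E]
  {T : E →ₗ[ℝ] E} {n : ℕ}

theorem LinearMap.IsSymmetric.inner_apply_self_eq_sum (hT : T.IsSymmetric)
    (hn : Module.finrank ℝ E = n) (z : E) :
    inner ℝ z (T z) = ∑ j, hT.eigenvalues hn j * inner ℝ (hT.eigenvectorBasis hn j) z ^ 2 := by
  rw [← (hT.eigenvectorBasis hn).sum_inner_mul_inner]
  refine Finset.sum_congr rfl fun j _ => ?_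
  rw [← hT, hT.apply_eigenvectorBasis hn, inner_smul_left, real_inner_comm]
  simp
  ring

theorem LinearMap.IsSymmetric.inner_self_eq_sum (hT : T.IsSymmetric)
    (hn : Module.finrank ℝ E = n) (z : E) :
    inner ℝ z z = ∑ j, inner ℝ (hT.eigenvectorBasis hn j) z ^ 2 := by
  rw [← (hT.eigenvectorBasis hn).sum_inner_mul_inner]
  refine Finset.sum_congr rfl fun j _ => ?_
  rw [real_inner_comm, sq]

/-- A plane meets every hyperplane nontrivially. With `e` an extreme eigenvector, this yields a test
vector without that component, so the next eigenvalue bounds its Rayleigh quotient. -/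
theorem exists_ne_zero_inner_smul_add_smul_eq_zero {E : Type*} [NormedAddCommGroup E]
    [InnerProductSpace ℝ E] (e x y : E) :
    ∃ α β : ℝ, (α ≠ 0 ∨ β ≠ 0) ∧ inner ℝ e (α • x + β • y) = 0 := by
  by_cases h : inner ℝ e x = 0
  · exact ⟨1, 0, Or.inl one_ne_zero, by simp [h]⟩
  · refine ⟨inner ℝ e y, -inner ℝ e x, Or.inr (neg_ne_zero.2 h), ?_⟩
    rw [inner_add_right, inner_smul_right, inner_smul_right]
    ring

/-- If the Rayleigh quotient is at least `c` on a plane, then so is the second largest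
eigenvalue. -/
theorem LinearMap.IsSymmetric.le_eigenvalues_one (hT : T.IsSymmetric)
    (hn : Module.finrank ℝ E = n) (h1 : 1 < n) {c : ℝ} {x y : E}
    (hpos : ∀ α β : ℝ, (α ≠ 0 ∨ β ≠ 0) → α • x + β • y ≠ 0)
    (hc : ∀ α β : ℝ, c * inner ℝ (α • x + β • y) (α • x + β • y) ≤
      inner ℝ (α • x + β • y) (T (α • x + β • y))) :
    c ≤ hT.eigenvalues hn ⟨1, h1⟩ := by
  obtain ⟨α, β, hne, horth⟩ := exists_ne_zero_inner_smul_add_smul_eq_zero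
    (hT.eigenvectorBasis hn ⟨0, by omega⟩) x y
  have h := hc α β
  set z := α • x + β • y
  have hz : 0 < inner ℝ z z := real_inner_self_pos.2 (hpos α β hne)
  refine le_of_mul_le_mul_right (h.trans ?_) hz
  rw [hT.inner_apply_self_eq_sum hn, hT.inner_self_eq_sum hn, Finset.mul_sum]
  refine Finset.sum_le_sum fun j _ => ?_
  rcases Nat.eq_zero_or_pos j.1 with hj | hj
  · rw [show j = ⟨0, by omega⟩ from Fin.ext hj, horth]
    simp
  · exact mul_le_mul_of_nonneg_right (hT.eigenvalues_antitone hn (Fin.mk_le_of_le_val hj))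
      (sq_nonneg _)

/-- If the Rayleigh quotient is at most `c` on a plane, then so is the second smallest
eigenvalue. -/
theorem LinearMap.IsSymmetric.eigenvalues_sub_two_le (hT : T.IsSymmetric)
    (hn : Module.finrank ℝ E = n) (h1 : 1 < n) {c : ℝ} {x y : E}
    (hpos : ∀ α β : ℝ, (α ≠ 0 ∨ β ≠ 0) → α • x + β • y ≠ 0)
    (hc : ∀ α β : ℝ, inner ℝ (α • x + β • y) (T (α • x + β • y)) ≤
      c * inner ℝ (α • x + β • y) (α • x + β • y)) :
    hT.eigenvalues hn ⟨n - 1 - 1, by omega⟩ ≤ c := by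
  obtain ⟨α, β, hne, horth⟩ := exists_ne_zero_inner_smul_add_smul_eq_zero
    (hT.eigenvectorBasis hn ⟨n - 1, by omega⟩) x y
  have h := hc α β
  set z := α • x + β • y
  have hz : 0 < inner ℝ z z := real_inner_self_pos.2 (hpos α β hne)
  refine le_of_mul_le_mul_right (le_trans ?_ h) hz
  rw [hT.inner_apply_self_eq_sum hn, hT.inner_self_eq_sum hn, Finset.mul_sum]
  refine Finset.sum_le_sum fun j _ => ?_
  rcases Nat.eq_or_lt_of_le (Nat.le_sub_one_of_lt j.2) with hj | hj
  · rw [show j = ⟨n - 1, by omega⟩ from Fin.ext hj, horth]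
    simp
  · exact mul_le_mul_of_nonneg_right (hT.eigenvalues_antitone hn
      (Fin.le_def.2 (Nat.le_sub_one_of_lt hj))) (sq_nonneg _)

end Rayleigh

/-! ### The quadratic form of `aD + bA` on two-valued vectors -/

namespace SimpleGraph

open Finset Matrix

variable {V : Type*} [Fintype V] [DecidableEq V] {G : SimpleGraph V} [DecidableRel G.Adj]
  {X Y : Finset V}

/-- The number of edges of `G` from `X` to `Y`, for disjoint `X` and `Y`. -/
def edgesBetween (G : SimpleGraph V) [DecidableRel G.Adj] (X Y : Finset V) : ℕ :=
  ∑ x ∈ X, (G.neighborFinset x ∩ Y).card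

theorem edgesBetween_comm (G : SimpleGraph V) [DecidableRel G.Adj] (X Y : Finset V) :
    G.edgesBetween X Y = G.edgesBetween Y X := by
  have key : ∀ X Y : Finset V,
      G.edgesBetween X Y = ∑ x ∈ X, ∑ y ∈ Y, if G.Adj x y then 1 else 0 := by
    intro X Y
    refine sum_congr rfl fun x _ => ?_
    rw [← card_filter]
    congr 1
    ext y
    simp [and_comm]
  rw [key, key, sum_comm]
  exact sum_congr rfl fun x _ => sum_congr rfl fun y _ => by simp [G.adj_comm]

/-- This is `aD + bA = (a+b)D - bL`; the double sum runs over ordered pairs, hence the division by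
two. -/
theorem dotProduct_degAdjMatrix_mulVec (a b : ℝ) (z : V → ℝ) :
    z ⬝ᵥ (G.degAdjMatrix a b *ᵥ z) = (a + b) * ∑ v, G.degree v * z v ^ 2
      - b * ((∑ u, ∑ v, if G.Adj u v then (z u - z v) ^ 2 else 0) / 2) := by
  have h1 : G.degAdjMatrix a b = (a + b) • G.degMatrix ℝ - b • G.lapMatrix ℝ := by
    rw [degAdjMatrix, lapMatrix, smul_sub, add_smul]
    abel
  have h2 : z ⬝ᵥ (G.lapMatrix ℝ *ᵥ z) =
      (∑ u, ∑ v, if G.Adj u v then (z u - z v) ^ 2 else 0) / 2 := by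
    rw [← lapMatrix_toLinearMap₂', toLinearMap₂'_apply']
  have h3 : z ⬝ᵥ (G.degMatrix ℝ *ᵥ z) = ∑ v, G.degree v * z v ^ 2 := by
    simp only [degMatrix, dotProduct, mulVec_diagonal]
    exact sum_congr rfl fun v _ => by ring
  rw [h1, sub_mulVec, dotProduct_sub, smul_mulVec, smul_mulVec, dotProduct_smul, dotProduct_smul,
    h2, h3, smul_eq_mul, smul_eq_mul]

/-- The vector with value `α` on `X`, value `β` on `Y \ X` and `0` elsewhere. -/
def twoValued (X Y : Finset V) (α β : ℝ) (v : V) : ℝ :=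
  if v ∈ X then α else if v ∈ Y then β else 0

theorem sum_mul_twoValued_sq (hXY : Disjoint X Y) (α β : ℝ) :
    ∑ v, twoValued X Y α β v ^ 2 = α ^ 2 * X.card + β ^ 2 * Y.card := by
  have h : ∀ v, twoValued X Y α β v ^ 2 =
      (if v ∈ X then α ^ 2 else 0) + (if v ∈ Y then β ^ 2 else 0) := by
    intro v
    unfold twoValued
    by_cases h1 : v ∈ X
    · simp [h1, Finset.disjoint_left.1 hXY h1]
    · by_cases h2 : v ∈ Y <;> simp [h1, h2]
  simp_rw [h, sum_add_distrib, ← sum_filter]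
  simp [mul_comm]

theorem sum_adj_twoValued_le (hXY : Disjoint X Y) (α β : ℝ) :
    (∑ u, ∑ v, if G.Adj u v then (twoValued X Y α β u - twoValued X Y α β v) ^ 2 else 0) / 2 ≤
      α ^ 2 * (∑ x ∈ X, G.outDegree X x + G.edgesBetween X Y : ℕ) +
      β ^ 2 * (∑ y ∈ Y, G.outDegree Y y + G.edgesBetween Y X : ℕ) := by
  -- The charge of an ordered pair to its first vertex: `α²` if the edge leaves `X`, once more if it
  -- ends in `Y`, and symmetrically for `β`.
  set f : V → V → ℝ := fun u v => if G.Adj u v then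
    α ^ 2 * ((if u ∈ X then 1 else 0) * ((if v ∈ X then 0 else 1) + (if v ∈ Y then 1 else 0))) +
    β ^ 2 * ((if u ∈ Y then 1 else 0) * ((if v ∈ Y then 0 else 1) + (if v ∈ X then 1 else 0)))
    else 0 with hf
  have hle : ∀ u v, (if G.Adj u v then (twoValued X Y α β u - twoValued X Y α β v) ^ 2 else 0) ≤
      f u v + f v u := by
    intro u v
    have hcases : ∀ w, (w ∈ X ∧ w ∉ Y) ∨ (w ∉ X ∧ w ∈ Y) ∨ (w ∉ X ∧ w ∉ Y) := by
      intro w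
      have := fun h : w ∈ X => Finset.disjoint_left.1 hXY h
      tauto
    by_cases h : G.Adj u v
    · simp only [hf, if_pos h, if_pos h.symm, twoValued]
      rcases hcases u with ⟨h1, h2⟩ | ⟨h1, h2⟩ | ⟨h1, h2⟩ <;>
        rcases hcases v with ⟨h3, h4⟩ | ⟨h3, h4⟩ | ⟨h3, h4⟩ <;>
        simp only [h1, h2, h3, h4, if_true, if_false] <;>
        -- Only edges between `X` and `Y` are not immediate; there `(α-β)² ≤ 2α² + 2β²`.
        nlinarith [sq_nonneg (α + β), sq_nonneg α, sq_nonneg β]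
    · simp [hf, h, mt Adj.symm h]
  have hcount : ∀ X Y : Finset V,
      ∑ u, ∑ v, (if G.Adj u v then ((if u ∈ X then 1 else 0) *
        ((if v ∈ X then 0 else 1) + (if v ∈ Y then 1 else 0)) : ℝ) else 0) =
      (∑ x ∈ X, G.outDegree X x + G.edgesBetween X Y : ℕ) := by
    intro X Y
    rw [edgesBetween, ← sum_add_distrib, ← sum_filter_add_sum_filter_not univ (· ∈ X)]
    rw [sum_eq_zero (s := univ.filter (· ∉ X))]
    · rw [filter_mem_eq_inter, univ_inter, add_zero, Nat.cast_sum]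
      refine sum_congr rfl fun u hu => ?_
      rw [outDegree, Nat.cast_add, card_eq_sum_ones, card_eq_sum_ones, Nat.cast_sum, Nat.cast_sum,
        sdiff_eq_filter, ← filter_mem_eq_inter, sum_filter, sum_filter, ← sum_add_distrib,
        neighborFinset_eq_filter, sum_filter]
      refine sum_congr rfl fun v _ => ?_
      by_cases h : v ∈ X <;> simp [hu, h]
    · intro u hu
      simp [(mem_filter.1 hu).2]
  have hsum : ∑ u, ∑ v, f u v =
      α ^ 2 * (∑ x ∈ X, G.outDegree X x + G.edgesBetween X Y : ℕ) +
      β ^ 2 * (∑ y ∈ Y, G.outDegree Y y + G.edgesBetween Y X : ℕ) := by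
    rw [← hcount X Y, ← hcount Y X, mul_sum, mul_sum, ← sum_add_distrib]
    refine sum_congr rfl fun u _ => ?_
    rw [mul_sum, mul_sum, ← sum_add_distrib]
    refine sum_congr rfl fun v _ => ?_
    simp only [hf]
    split_ifs <;> simp
  have htotal := sum_le_sum fun u (_ : u ∈ univ) => sum_le_sum fun v (_ : v ∈ univ) => hle u v
  simp_rw [sum_add_distrib] at htotal
  rw [sum_comm (f := fun u v => f v u), hsum] at htotal
  linarith

/-- Sandwich for the quadratic form of `aD + bA` on the vectors that take two values on two disjoint
sets with small edge boundaries. -/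
theorem quadraticForm_bounds (hXY : Disjoint X Y) {r : ℝ}
    (hX : (∑ x ∈ X, G.outDegree X x + G.edgesBetween X Y : ℕ) ≤ r * X.card)
    (hY : (∑ y ∈ Y, G.outDegree Y y + G.edgesBetween Y X : ℕ) ≤ r * Y.card)
    (a b α β : ℝ) :
    (0 ≤ b → 0 ≤ a + b →
      ((a + b) * G.minDegree - b * r) * ∑ v, twoValued X Y α β v ^ 2 ≤
        twoValued X Y α β ⬝ᵥ (G.degAdjMatrix a b *ᵥ twoValued X Y α β)) ∧
    (b ≤ 0 → a + b ≤ 0 →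
      twoValued X Y α β ⬝ᵥ (G.degAdjMatrix a b *ᵥ twoValued X Y α β) ≤
        ((a + b) * G.minDegree - b * r) * ∑ v, twoValued X Y α β v ^ 2) := by
  rw [dotProduct_degAdjMatrix_mulVec]
  set z := twoValued X Y α β with hz
  have h1 : (∑ u, ∑ v, if G.Adj u v then (z u - z v) ^ 2 else 0) / 2 ≤ r * ∑ v, z v ^ 2 := by
    refine (sum_adj_twoValued_le hXY α β).trans ?_
    rw [hz, sum_mul_twoValued_sq hXY]
    nlinarith [mul_le_mul_of_nonneg_left hX (sq_nonneg α),
      mul_le_mul_of_nonneg_left hY (sq_nonneg β)]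
  have h2 : G.minDegree * ∑ v, z v ^ 2 ≤ ∑ v, G.degree v * z v ^ 2 := by
    rw [mul_sum]
    exact sum_le_sum fun v _ => mul_le_mul_of_nonneg_right
      (by exact_mod_cast G.minDegree_le_degree v) (sq_nonneg _)
  constructor
  · intro hb hab
    have h3 := mul_le_mul_of_nonneg_left h1 hb
    have h4 := mul_le_mul_of_nonneg_left h2 hab
    linarith
  · intro hb hab
    have h3 := mul_le_mul_of_nonpos_left h1 hb
    have h4 := mul_le_mul_of_nonpos_left h2 hab
    linarith

theorem degAdjEigenvalue_bounds (hXY : Disjoint X Y) (hXne : X.Nonempty) (hYne : Y.Nonempty)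
    {r : ℝ} (hX : (∑ x ∈ X, G.outDegree X x + G.edgesBetween X Y : ℕ) ≤ r * X.card)
    (hY : (∑ y ∈ Y, G.outDegree Y y + G.edgesBetween Y X : ℕ) ≤ r * Y.card) (a b : ℝ) :
    (0 ≤ b → 0 ≤ a + b → (a + b) * G.minDegree - b * r ≤ G.degAdjEigenvalue a b 2) ∧
    (b ≤ 0 → a + b ≤ 0 →
      G.degAdjEigenvalue a b (Fintype.card V - 1) ≤ (a + b) * G.minDegree - b * r) := by
  have hcard : 1 < Fintype.card V := by
    have h1 := (card_union_of_disjoint hXY).symm.trans_le (card_le_univ (X ∪ Y))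
    have h2 := hXne.card_pos
    have h3 := hYne.card_pos
    omega
  set x : EuclideanSpace ℝ V := WithLp.toLp 2 (twoValued X Y 1 0) with hx
  set y : EuclideanSpace ℝ V := WithLp.toLp 2 (twoValued X Y 0 1) with hy
  have hcomb : ∀ α β : ℝ, α • x + β • y = WithLp.toLp 2 (twoValued X Y α β) := by
    intro α β
    ext v
    simp only [hx, hy, twoValued, PiLp.add_apply, PiLp.smul_apply, smul_eq_mul]
    split_ifs <;> simp
  have hinner : ∀ α β : ℝ, inner ℝ (α • x + β • y) (α • x + β • y) =
      ∑ v, twoValued X Y α β v ^ 2 := by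
    intro α β
    rw [hcomb, real_inner_self_eq_norm_sq, EuclideanSpace.norm_sq_eq]
    simp
  have hpos : ∀ α β : ℝ, (α ≠ 0 ∨ β ≠ 0) → α • x + β • y ≠ 0 := by
    intro α β hne h0
    have h := hinner α β
    rw [h0, inner_zero_left, sum_mul_twoValued_sq hXY] at h
    have h2 : (0 : ℝ) < X.card := by exact_mod_cast hXne.card_pos
    have h3 : (0 : ℝ) < Y.card := by exact_mod_cast hYne.card_pos
    rcases hne with hne | hne
    · have : 0 < α ^ 2 * X.card := by positivity
      nlinarith [mul_nonneg (sq_nonneg β) h3.le]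
    · have : 0 < β ^ 2 * Y.card := by positivity
      nlinarith [mul_nonneg (sq_nonneg α) h2.le]
  have hform : ∀ α β : ℝ, inner ℝ (α • x + β • y)
      (Matrix.toEuclideanLin (G.degAdjMatrix a b) (α • x + β • y)) =
      twoValued X Y α β ⬝ᵥ (G.degAdjMatrix a b *ᵥ twoValued X Y α β) := by
    intro α β
    rw [hcomb, EuclideanSpace.inner_eq_star_dotProduct, dotProduct_comm]
    simp
  have hT := isSymmetric_toEuclideanLin_iff.mpr (G.degAdjMatrix_isHermitian a b)
  constructor
  · intro hb hab
    rw [degAdjEigenvalue, dif_pos ⟨by omega, by omega⟩]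
    refine hT.le_eigenvalues_one finrank_euclideanSpace hcard hpos fun α β => ?_
    rw [hinner, hform]
    exact (quadraticForm_bounds hXY hX hY a b α β).1 hb hab
  · intro hb hab
    -- The one-based position `|V| - 1` becomes the zero-based index `|V| - 1 - 1`, the second
    -- smallest.
    rw [degAdjEigenvalue, dif_pos ⟨by omega, by omega⟩]
    refine hT.eigenvalues_sub_two_le finrank_euclideanSpace hcard hpos fun α β => ?_
    rw [hinner, hform]
    exact (quadraticForm_bounds hXY hX hY a b α β).2 hb hab

end SimpleGraph

/-! ### Two parts with small boundaries, and the conclusion -/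

namespace SimpleGraph

open Finset

/-- If `G` has no `k` edge-disjoint spanning trees, then there are two disjoint nonempty sets of
vertices whose edge boundaries are small, even if the edges between the two are counted twice. -/
theorem exists_disjoint_pair_of_not_isSpanningTreePacking {V : Type*} [Fintype V] [DecidableEq V]
    [Nonempty V] (G : SimpleGraph V) [DecidableRel G.Adj] (k : ℕ)
    (h : ¬ ∃ T : Fin k → SimpleGraph V, G.IsSpanningTreePacking T) :
    ∃ X Y : Finset V, Disjoint X Y ∧ X.Nonempty ∧ Y.Nonempty ∧
      ∑ x ∈ X, G.outDegree X x + G.edgesBetween X Y + 1 ≤ 2 * k ∧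
      ∑ y ∈ Y, G.outDegree Y y + G.edgesBetween Y X + 1 ≤ 2 * k := by
  classical
  obtain ⟨K, hK⟩ := G.exists_crossGraph_lt_of_not_isSpanningTreePacking k h
  set P : K.ConnectedComponent → Finset V := fun c => {v | K.connectedComponentMk v = c} with hP
  have hmem : ∀ {v c}, v ∈ P c ↔ K.connectedComponentMk v = c := by simp [hP]
  have hPdisj : ∀ c c', c ≠ c' → Disjoint (P c) (P c') := by
    intro c c' hne
    rw [Finset.disjoint_left]
    exact fun v hv hv' => hne ((hmem.1 hv).symm.trans (hmem.1 hv'))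
  have hPne : ∀ c, (P c).Nonempty := by
    intro c
    induction c using ConnectedComponent.ind with
    | h v => exact ⟨v, hmem.2 rfl⟩
  set d : K.ConnectedComponent → ℕ := fun c => ∑ x ∈ P c, G.outDegree (P c) x with hd
  -- A vertex has as many neighbours outside its own part as its degree in the cross graph, so this
  -- is the handshake lemma.
  have hsum : ∑ c, d c = 2 * (G.crossGraph K).edgeSet.ncard := by
    have h1 := (G.crossGraph K).sum_degrees_eq_twice_card_edges
    have h2 : (G.crossGraph K).edgeFinset.card = (G.crossGraph K).edgeSet.ncard := by
      rw [Set.ncard_eq_toFinset_card']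
      rfl
    rw [← h2, ← h1, ← sum_fiberwise univ K.connectedComponentMk
      (fun v => (G.crossGraph K).degree v)]
    refine sum_congr rfl fun c _ => sum_congr rfl fun x hx => ?_
    rw [outDegree, ← card_neighborFinset_eq_degree]
    congr 1
    ext y
    have hx' : K.connectedComponentMk x = c := hmem.1 hx
    rw [mem_sdiff, mem_neighborFinset, mem_neighborFinset, hmem, ← hx', eq_comm,
      ConnectedComponent.eq]
    rfl
  have hbetween : ∀ c, ∑ c' ∈ univ.erase c, G.edgesBetween (P c) (P c') ≤ d c := by
    intro c
    simp only [edgesBetween, hd]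
    rw [sum_comm]
    refine sum_le_sum fun x _ => ?_
    rw [← card_biUnion fun c' _ c'' _ hne =>
      (hPdisj c' c'' hne).mono inter_subset_right inter_subset_right]
    refine card_le_card (biUnion_subset.2 fun c' hc' y hy => ?_)
    rw [mem_inter] at hy
    exact mem_sdiff.2 ⟨hy.1, Finset.disjoint_left.1 (hPdisj c' c (ne_of_mem_erase hc')) hy.2⟩
  obtain ⟨c₀, -, hc₀⟩ := exists_min_image univ d
    ⟨K.connectedComponentMk (Classical.arbitrary V), mem_univ _⟩
  by_contra! hno
  -- Since `d c₀ ≤ d c`, the bound for `c` would imply the bound for `c₀`; so if no pair works, it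
  -- must fail at `c`.
  have hlarge : ∀ c ∈ univ.erase c₀, 2 * k ≤ d c + G.edgesBetween (P c₀) (P c) := by
    intro c hc
    by_contra! hlt
    have h1 := hc₀ c (mem_univ c)
    have h2 := hno (P c₀) (P c) (hPdisj c₀ c (ne_of_mem_erase hc).symm) (hPne c₀) (hPne c)
      (by change d c₀ + _ + 1 ≤ _; omega)
    rw [G.edgesBetween_comm (P c)] at h2
    change _ < d c + _ + 1 at h2
    omega
  have h1 := sum_le_sum hlarge
  rw [sum_const, sum_add_distrib, card_erase_of_mem (mem_univ _), card_univ, smul_eq_mul] at h1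
  have h2 := hbetween c₀
  have h3 := add_sum_erase univ d (mem_univ c₀)
  rw [Nat.card_eq_fintype_card] at hK
  have h4 : 1 ≤ Fintype.card K.ConnectedComponent := Fintype.card_pos_iff.2 ⟨c₀⟩
  obtain ⟨s, hs⟩ := Nat.exists_eq_add_of_le' h4
  rw [hs] at h1 hK
  rw [Nat.add_sub_cancel] at h1
  -- With `s + 1` parts: `2ks ≤ ∑_{c ≠ c₀} d c + d c₀`, which is twice the number of crossing edges
  -- and hence at most `2(ks - 1)`.
  nlinarith

theorem le_spanningTreePackingNumber {V : Type*} {G : SimpleGraph V} {k : ℕ}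
    (h : ∃ T : Fin k → SimpleGraph V, G.IsSpanningTreePacking T) :
    (k : ℕ∞) ≤ G.spanningTreePackingNumber := by
  obtain ⟨T, hT⟩ := h
  exact le_sSup ⟨k, T, hT, rfl⟩

theorem mooreTypeBound_pos (δ g : ℕ) : 0 < mooreTypeBound δ g := by
  unfold mooreTypeBound
  simp only
  split_ifs <;> omega

end SimpleGraph

theorem corollary4p2 {V : Type*} [Fintype V] [DecidableEq V]
    (G : SimpleGraph V) [DecidableRel G.Adj]
    (a b : ℝ) (hb : b ≠ 0) (hab : -1 ≤ a / b)
    (k : ℕ) (hk : 0 < k) (hδ : 2 * k ≤ G.minDegree) :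
    (0 < b →
      G.degAdjEigenvalue a b 2 <
        (a + b) * (G.minDegree : ℝ)
          - b * (2 * (k : ℝ) - 1) / (mooreTypeBound G.minDegree G.girth : ℝ) →
      (k : ℕ∞) ≤ G.spanningTreePackingNumber) ∧
    (b < 0 →
      G.degAdjEigenvalue a b (Fintype.card V - 1) >
        (a + b) * (G.minDegree : ℝ)
          - b * (2 * (k : ℝ) - 1) / (mooreTypeBound G.minDegree G.girth : ℝ) →
      (k : ℕ∞) ≤ G.spanningTreePackingNumber) := by
  have hne : Nonempty V := by
    by_contra hemp
    rw [not_nonempty_iff] at hemp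
    simp at hδ
    omega
  by_cases hT : ∃ T : Fin k → SimpleGraph V, G.IsSpanningTreePacking T
  · have h := SimpleGraph.le_spanningTreePackingNumber hT
    exact ⟨fun _ _ => h, fun _ _ => h⟩
  obtain ⟨X, Y, hXY, hXne, hYne, hX, hY⟩ :=
    G.exists_disjoint_pair_of_not_isSpanningTreePacking k hT
  set N := mooreTypeBound G.minDegree G.girth
  have hN : (0 : ℝ) < N := by exact_mod_cast SimpleGraph.mooreTypeBound_pos _ _
  have hbound : ∀ (Z : Finset V) (m : ℕ), Z.Nonempty →
      ∑ x ∈ Z, G.outDegree Z x + m + 1 ≤ 2 * k →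
      ((∑ x ∈ Z, G.outDegree Z x + m : ℕ) : ℝ) ≤ (2 * (k : ℝ) - 1) / N * Z.card := by
    intro Z m hZ hm
    -- The boundary alone, without `m`, is below `2k ≤ δ`, as the Moore-type bound requires.
    have h1 : (N : ℝ) ≤ Z.card := by
      exact_mod_cast SimpleGraph.mooreTypeBound_le_card (by omega) hZ (by omega)
    have h2 : ((∑ x ∈ Z, G.outDegree Z x + m : ℕ) : ℝ) + 1 ≤ 2 * k := by exact_mod_cast hm
    have h3 : (0 : ℝ) ≤ 2 * k - 1 := by
      have : (1 : ℝ) ≤ k := by exact_mod_cast hk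
      linarith
    calc ((∑ x ∈ Z, G.outDegree Z x + m : ℕ) : ℝ) ≤ 2 * k - 1 := by linarith
      _ = (2 * k - 1) / N * N := by field_simp
      _ ≤ _ := by gcongr
  have hspec := SimpleGraph.degAdjEigenvalue_bounds hXY hXne hYne (hbound X _ hXne hX)
    (hbound Y _ hYne hY) a b
  rw [← mul_div_assoc] at hspec
  constructor
  · intro hb0 hlt
    have hab' : 0 ≤ a + b := by
      have := (le_div_iff₀ hb0).1 hab
      linarith
    exact absurd hlt (not_lt.2 (hspec.1 hb0.le hab'))
  · intro hb0 hlt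
    have hab' : a + b ≤ 0 := by
      have := (le_div_iff_of_neg hb0).1 hab
      linarith
    exact absurd hlt (not_lt.2 (hspec.2 hb0.le hab'))
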